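/- A partition is a (possibly empty) finite non-increasing sequence $\lambda=(\lambda_1,\dots,\lambda_\ell)$ of positive integers; its Young diagram has $\lambda_i$ left-justified boxes in row $i$. A box is an (inner) corner if removing it leaves the Young diagram of a partition. The hook length of a box is the number of boxes to its right in its row plus the number of boxes below it in its column plus $1$. For an integer $t\ge 1$, $\lambda$ is a $t$-core if no box of its Young diagram has hook length $t$. $\lambda$ is self-conjugate if its Young diagram is invariant under exchanging rows and columns. For integers $t,m\ge 0$ put $\operatorname{scc}(t,0)=1$ and, for $m>0$, \[ \operatorname{scc}(t,m)=\sum_{i=1}^{\min(m,\lfloor t/2\rfloor)}\binom{\lfloor \frac{m-1}{2}\rfloor}{\lfloor\frac{i-1}{2}\rfloor}\binom{\lfloor\frac m2\rfloor}{\lfloor\frac i2\rfloor}\binom{\lfloor\frac t2\rfloor+m-i}{m}. \] Proposition. For all integers $t\ge 1$ and $m\ge 0$, the set of self-conjugate $t$-core partitions with exactly $m$ corners is finite and has $\operatorname{scc}(t,m)$ elements. In addition, $\operatorname{scc}(t,m)=\operatorname{scc}(t+1,m)$ for every even $t\ge 0$ and every $m\ge 0$; in particular, for even $t\ge 2$ there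 are as many self-conjugate $t$-cores with $m$ corners as self-conjugate $(t+1)$-cores with $m$ corners. -/

import Mathlib

namespace YoungDiagram

/-- The hook length of the box `(i, j)` of `μ`: the number of boxes to its right in row `i`, plus
the number of boxes below it in column `j`, plus one for the box itself. It is meant only for
`(i, j) ∈ μ`; then `j + 1 ≤ μ.rowLen i` and `i + 1 ≤ μ.colLen j`, so no subtraction truncates. -/
def hookLength (μ : YoungDiagram) (i j : ℕ) : ℕ :=
  (μ.rowLen i - (j + 1)) + (μ.colLen j - (i + 1)) + 1

/-- `μ` is a `t`-core if no box of `μ` has hook length `t`. -/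
def IsCore (μ : YoungDiagram) (t : ℕ) : Prop :=
  ∀ i j : ℕ, (i, j) ∈ μ → μ.hookLength i j ≠ t

/-- The (inner) corners of `μ`: the boxes whose removal leaves a Young diagram. -/
def innerCorners (μ : YoungDiagram) : Set (ℕ × ℕ) :=
  {c | c ∈ μ ∧ IsLowerSet (μ.cells.erase c : Set (ℕ × ℕ))}

/-- The number of (inner) corners of `μ`; the set of corners is finite, being part of `μ`. -/
noncomputable def numCorners (μ : YoungDiagram) : ℕ :=
  μ.innerCorners.ncard

/-- `μ` is self-conjugate if it equals its conjugate (the diagram with rows and columns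
exchanged). -/
def IsSelfConjugate (μ : YoungDiagram) : Prop :=
  μ.transpose = μ

end YoungDiagram

/-- The set of self-conjugate `t`-core partitions with `m` corners. A partition is represented by
its Young diagram (`YoungDiagram.equivListRowLens` is the bijection with non-increasing lists of
positive integers). -/
def selfConjugateCores (t m : ℕ) : Set YoungDiagram :=
  {μ | μ.IsSelfConjugate ∧ μ.IsCore t ∧ μ.numCorners = m}

/-- The number `scc(t, m)`. In the sum `1 ≤ i ≤ m`, so no natural-number subtraction truncates, and
`/ 2` is the floor of the half. -/
def scc (t m : ℕ) : ℕ :=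
  if m = 0 then 1
  else ∑ i ∈ Finset.Icc 1 (min m (t / 2)),
    Nat.choose ((m - 1) / 2) ((i - 1) / 2) * Nat.choose (m / 2) (i / 2) *
      Nat.choose (t / 2 + m - i) m

/-! Encode a partition by its beads `rowLen i - i - 1`. Self-conjugacy makes the bead set `S`
antisymmetric: exactly one of `x`, `-1 - x` lies in `S`. Being a `t`-core means that `S` is closed
under subtracting `t`, and corners are the beads whose predecessor is missing. Such sets are exactly
the bead sets of self-conjugate `t`-cores (`encard_selfConjugateCores`).

On the `t`-abacus every runner is filled up to some charge, and mirror runners have opposite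
charges. So the first `t / 2` charges `c` are free and determine `S`, and the number of corners is
`max (2 * c 0 - 1) 0 + 2 * ascent (t / 2) c` (`ncard_runStarts_chargeBeads`). The parity of `m`
decides the sign of `c 0`; after negating `c` for odd `m`, both cases count walks ending at 0 with
ascent `⌈m/2⌉` and, including a first nonpositive step, descent `⌊m/2⌋` (`encard_charges`).

To count these walks, spell each one in unit letters: a word with `i` changes forces `i` of the `n`
separators between steps, and the other `n - i` go anywhere. This explains the formula `walkCount`;
the proof checks that both sides obey one recurrence (`encard_walks`). -/

/-! ### Words, and the recurrence for the closed formula -/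

/-- The number of words with `p` letters `U` and `s` letters `D` which have `i` letter changes once
a letter `D` is put in front. -/
def wordCount (p s i : ℕ) : ℕ :=
  if i = 0 then (if p = 0 then 1 else 0)
  else if p = 0 then 0 else (p - 1).choose ((i - 1) / 2) * s.choose (i / 2)

/-- The number of integer walks of `n` further steps after a first nonpositive one with total ascent
`p` and total descent `s`. -/
def walkCount (n p s : ℕ) : ℕ :=
  ∑ i ∈ Finset.range (n + 1), wordCount p s i * (n - i + (p + s)).choose (p + s)

theorem wordCount_zero_succ (s i : ℕ) : wordCount 0 (s + 1) i = wordCount 0 s i := by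
  simp [wordCount]

theorem wordCount_succ_zero_succ (p i : ℕ) :
    wordCount (p + 1) 0 (i + 1) = wordCount 0 p i := by
  rcases i with _ | i
  · simp [wordCount]
  · have : (i + 1 + 1) / 2 = i / 2 + 1 := by omega
    simp [wordCount, this]

/-- Split by the first letter: `D` can be absorbed into the `D` in front; `U` uses up one change,
and exchanging the two letters then restores the convention. -/
theorem wordCount_succ_succ_succ (p s i : ℕ) :
    wordCount (p + 1) (s + 1) (i + 1) =
      wordCount (p + 1) s (i + 1) + wordCount (s + 1) p i := by
  rcases i with _ | i
  · simp [wordCount]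
  · have : (i + 1 + 1) / 2 = i / 2 + 1 := by omega
    simp [wordCount, this, Nat.choose_succ_succ]
    ring

theorem walkCount_zero (p s : ℕ) : walkCount 0 p s = if p = 0 then 1 else 0 := by
  simp [walkCount, wordCount]

theorem walkCount_pascal (n p s k : ℕ) (h : p + s = k + 1) :
    walkCount (n + 1) p s =
      ∑ i ∈ Finset.range (n + 2), wordCount p s i * (n + 1 - i + k).choose k +
        walkCount n p s := by
  have h1 : walkCount (n + 1) p s = ∑ i ∈ Finset.range (n + 2),
      (wordCount p s i * (n + 1 - i + k).choose k +
        wordCount p s i * (n + 1 - i + k).choose (k + 1)) := by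
    unfold walkCount
    refine Finset.sum_congr rfl fun i _ => ?_
    rw [h, ← mul_add, ← Nat.choose_succ_succ]
    rfl
  rw [h1, Finset.sum_add_distrib]
  congr 1
  rw [Finset.sum_range_succ, walkCount]
  simp only [Nat.sub_self, zero_add, Nat.choose_succ_self, mul_zero, add_zero]
  refine Finset.sum_congr rfl fun i hi => ?_
  have : i ≤ n := by simpa [Nat.lt_succ_iff] using hi
  rw [h]
  congr 2
  omega

theorem walkCount_zero_zero (n : ℕ) : walkCount n 0 0 = 1 := by
  unfold walkCount
  rw [Finset.sum_range_succ']
  simp [wordCount]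

theorem walkCount_succ_zero_succ (n s : ℕ) :
    walkCount (n + 1) 0 (s + 1) = walkCount (n + 1) 0 s + walkCount n 0 (s + 1) := by
  rw [walkCount_pascal n 0 (s + 1) s (by omega)]
  simp [walkCount, wordCount_zero_succ]

theorem walkCount_succ_succ_zero (n p : ℕ) :
    walkCount (n + 1) (p + 1) 0 = walkCount n (p + 1) 0 + walkCount n 0 p := by
  rw [walkCount_pascal n (p + 1) 0 p (by omega), Finset.sum_range_succ']
  simp only [wordCount_succ_zero_succ, Nat.reduceSubDiff]
  simp [walkCount, wordCount, add_comm]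

theorem walkCount_succ_succ_succ (n p s : ℕ) :
    walkCount (n + 1) (p + 1) (s + 1) =
      walkCount (n + 1) (p + 1) s + walkCount n (p + 1) (s + 1) + walkCount n (s + 1) p := by
  rw [walkCount_pascal n (p + 1) (s + 1) (p + s + 1) (by omega), Finset.sum_range_succ']
  have h : walkCount (n + 1) (p + 1) s = ∑ i ∈ Finset.range (n + 1),
      wordCount (p + 1) s (i + 1) * (n - i + (p + s + 1)).choose (p + s + 1) := by
    rw [walkCount, Finset.sum_range_succ', show p + 1 + s = p + s + 1 by omega]
    simp [wordCount]
  have h' : walkCount n (s + 1) p = ∑ i ∈ Finset.range (n + 1),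
      wordCount (s + 1) p i * (n - i + (p + s + 1)).choose (p + s + 1) := by
    rw [walkCount, show s + 1 + p = p + s + 1 by omega]
  rw [h, h', walkCount]
  simp only [wordCount_succ_succ_succ, add_mul, Finset.sum_add_distrib, Nat.reduceSubDiff]
  simp [wordCount]
  ring

theorem walkCount_eq_scc (t m : ℕ) : walkCount (t / 2) ((m + 1) / 2) (m / 2) = scc t m := by
  rcases Nat.eq_zero_or_pos m with rfl | hm
  · simp [walkCount_zero_zero, scc]
  · rw [walkCount, scc, if_neg hm.ne', show (m + 1) / 2 + m / 2 = m by omega]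
    symm
    refine Finset.sum_subset_zero_on_sdiff (fun i hi => ?_) (fun i hi => ?_) (fun i hi => ?_)
    · simp at hi ⊢; omega
    · simp only [Finset.mem_sdiff, Finset.mem_range, Finset.mem_Icc, not_and, not_le] at hi
      rcases Nat.eq_zero_or_pos i with rfl | hi0
      · simp [wordCount]; omega
      -- A word of `m` letters has at most `m` changes, so one of the two binomials vanishes.
      · have him : m < i := by have := hi.2 hi0; omega
        simp only [wordCount, hi0.ne', if_false, show (m + 1) / 2 ≠ 0 by omega]
        rcases Nat.even_or_odd' m with ⟨q, rfl | rfl⟩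
        · rw [Nat.choose_eq_zero_of_lt (n := (2 * q + 1) / 2 - 1) (by omega)]; simp
        · rw [Nat.choose_eq_zero_of_lt (n := (2 * q + 1) / 2) (k := i / 2) (by omega)]; simp
    · simp only [Finset.mem_Icc] at hi
      rw [wordCount, if_neg (by omega), if_neg (by omega),
        show (m + 1) / 2 - 1 = (m - 1) / 2 by omega, show t / 2 - i + m = t / 2 + m - i by omega]

/-! ### Integer walks -/

/-- The total ascent of the integer sequence `c` on `[0, n]`. -/
def ascent (n : ℕ) (c : ℕ → ℤ) : ℤ :=
  ∑ r ∈ Finset.range n, max (c (r + 1) - c r) 0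

theorem ascent_nonneg (n : ℕ) (c : ℕ → ℤ) : 0 ≤ ascent n c :=
  Finset.sum_nonneg fun _ _ => le_max_right _ _

theorem le_ascent (n : ℕ) (c : ℕ → ℤ) : c n - c 0 ≤ ascent n c := by
  rw [← Finset.sum_range_sub]
  exact Finset.sum_le_sum fun _ _ => le_max_left _ _

theorem ascent_neg (n : ℕ) (c : ℕ → ℤ) : ascent n (-c) = ascent n c - (c n - c 0) := by
  rw [← Finset.sum_range_sub, ascent, ascent, ← Finset.sum_sub_distrib]
  refine Finset.sum_congr rfl fun r _ => ?_
  simp only [Pi.neg_apply]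
  omega

theorem ascent_succ (n : ℕ) (c : ℕ → ℤ) :
    ascent (n + 1) c = ascent n (fun r => c (r + 1)) + max (c 1 - c 0) 0 := by
  rw [ascent, Finset.sum_range_succ', ascent]

theorem ascent_eq_of_le {n N : ℕ} (h : n ≤ N) {c : ℕ → ℤ} (hc : ∀ r, n ≤ r → c r = 0) :
    ascent N c = ascent n c := by
  symm
  refine Finset.sum_subset (by simpa using h) fun r _ hr => ?_
  have hr : n ≤ r := by simpa using hr
  simp [hc r hr, hc (r + 1) (by omega)]

/-- Integer sequences vanishing from index `n` on, starting at a value at most `a`, with total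
ascent `p`. -/
def walks (n : ℕ) (p a : ℤ) : Set (ℕ → ℤ) :=
  {c | (∀ r, n ≤ r → c r = 0) ∧ c 0 ≤ a ∧ ascent n c = p}

/-- The sequence `c` with a new first entry `a`. -/
def consSeq (a : ℤ) (c : ℕ → ℤ) : ℕ → ℤ
  | 0 => a
  | r + 1 => c r

theorem consSeq_injective (a : ℤ) : Function.Injective (consSeq a) := fun _ _ h =>
  funext fun r => congrFun h (r + 1)

theorem walks_eq_empty {n : ℕ} {p a : ℤ} (h : p + a < 0) : walks n p a = ∅ := by
  refine Set.eq_empty_of_forall_notMem fun c hc => ?_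
  obtain ⟨h1, h2, h3⟩ := hc
  have := le_ascent n c
  rw [h1 n le_rfl] at this
  omega

theorem walks_zero (p a : ℤ) : walks 0 p a = {c | c = 0 ∧ 0 ≤ a ∧ p = 0} := by
  ext c
  simp only [walks, ascent, Finset.range_zero, Finset.sum_empty, Set.mem_ofPred_eq, zero_le,
    true_imp_iff]
  constructor
  · rintro ⟨h1, h2, h3⟩
    exact ⟨funext h1, by rwa [h1] at h2, h3.symm⟩
  · rintro ⟨rfl, h2, h3⟩
    exact ⟨fun _ => rfl, h2, h3.symm⟩

/-- Either the start is below `a`, or it equals `a` and is dropped. If the next entry exceeds `a`,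
the tail is negated, so that its start is again bounded above; ascent and descent trade places. -/
theorem walks_succ (n : ℕ) (p a : ℤ) : walks (n + 1) p a =
    walks (n + 1) p (a - 1) ∪ (consSeq a '' walks n p a ∪
      (fun c => consSeq a (-c)) '' walks n (p + a) (-a - 1)) := by
  ext c
  constructor
  · rintro ⟨h1, h2, h3⟩
    rcases h2.lt_or_eq with h2 | h2
    · exact Or.inl ⟨h1, by omega, h3⟩
    have hc : c = consSeq a (fun r => c (r + 1)) := by
      funext r
      cases r
      · exact h2
      · rfl
    have h0 : ∀ r, n ≤ r → c (r + 1) = 0 := fun r hr => h1 _ (by omega)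
    rw [ascent_succ] at h3
    rcases le_or_gt (c 1) a with h4 | h4
    · exact Or.inr (Or.inl ⟨_, ⟨h0, h4, by omega⟩, hc.symm⟩)
    · refine Or.inr (Or.inr ⟨-fun r => c (r + 1), ⟨fun r hr => ?_, ?_, ?_⟩, ?_⟩)
      · simp [h0 r hr]
      · simp only [Pi.neg_apply, zero_add]; omega
      · rw [ascent_neg]
        have := h0 n le_rfl
        simp only [zero_add]
        omega
      · simp only [neg_neg]; exact hc.symm
  · rintro (⟨h1, h2, h3⟩ | ⟨d, ⟨h1, h2, h3⟩, rfl⟩ | ⟨d, ⟨h1, h2, h3⟩, rfl⟩)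
    · exact ⟨h1, by omega, h3⟩
    · refine ⟨fun r hr => ?_, le_rfl, ?_⟩
      · obtain ⟨r, rfl⟩ : ∃ q, r = q + 1 := ⟨r - 1, by omega⟩
        exact h1 r (by omega)
      · rw [ascent_succ]
        change ascent n d + max (d 0 - a) 0 = p
        omega
    · refine ⟨fun r hr => ?_, le_rfl, ?_⟩
      · obtain ⟨r, rfl⟩ : ∃ q, r = q + 1 := ⟨r - 1, by omega⟩
        change - d r = 0
        simp [h1 r (by omega)]
      · rw [ascent_succ]
        change ascent n (-d) + max (- d 0 - a) 0 = p
        rw [ascent_neg, h1 n le_rfl]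
        omega

theorem encard_walks_succ (n : ℕ) (p a : ℤ) : (walks (n + 1) p a).encard =
    (walks (n + 1) p (a - 1)).encard +
      ((walks n p a).encard + (walks n (p + a) (-a - 1)).encard) := by
  rw [walks_succ, Set.encard_union_eq, Set.encard_union_eq, (consSeq_injective a).encard_image,
    Function.Injective.encard_image]
  · exact (consSeq_injective a).comp neg_injective
  · rw [Set.disjoint_left]
    rintro _ ⟨c, hc, rfl⟩ ⟨d, hd, h⟩
    have h := congrFun (consSeq_injective a h) 0
    have h1 := hc.2.1
    have h2 := hd.2.1
    simp only [Pi.neg_apply] at h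
    omega
  · rw [Set.disjoint_left]
    rintro c hc (⟨d, -, rfl⟩ | ⟨d, -, rfl⟩) <;>
    · have : a ≤ a - 1 := hc.2.1
      omega

/-- With bound `s - p`, the negated walks have ascent `s` and bound `(p - 1) - s`, so the recurrence
stays within this family. -/
theorem encard_walks (n p s : ℕ) : (walks n p (s - p)).encard = walkCount n p s := by
  induction n generalizing p s with
  | zero =>
    rw [walks_zero, walkCount_zero]
    rcases p with _ | p
    · simp
    · have : ¬((p : ℤ) + 1 = 0) := by omega
      simp [this]
  | succ n ih =>
    induction s with
    | zero =>
      rw [encard_walks_succ, ih, walks_eq_empty (n := n + 1) (by push_cast; omega)]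
      rcases p with _ | p
      · rw [walks_eq_empty (a := -(((0 : ℕ) : ℤ) - (0 : ℕ)) - 1) (by simp)]
        simp [walkCount_zero_zero]
      · have h := ih 0 p
        rw [walkCount_succ_succ_zero]
        push_cast at h ⊢
        rw [← h]
        simp
    | succ s ihs =>
      rw [encard_walks_succ, ih, show ((s + 1 : ℕ) : ℤ) - p - 1 = s - p by push_cast; ring, ihs]
      rcases p with _ | p
      · rw [walks_eq_empty (by push_cast; omega), walkCount_succ_zero_succ]
        simp
      · have h := ih (s + 1) p
        rw [walkCount_succ_succ_succ]
        push_cast at h ⊢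
        rw [← h, ← add_assoc]
        congr 3 <;> ring

/-! ### Antisymmetric bead sets on the abacus -/

/-- The sets of integers that arise as bead sets of self-conjugate `t`-cores. -/
structure IsBeadSet (t : ℕ) (S : Set ℤ) : Prop where
  symm : ∀ x, x ∈ S ↔ -1 - x ∉ S
  sub_mem : ∀ x ∈ S, x - t ∈ S
  bddAbove : BddAbove S

/-- The elements of `S` whose predecessor is missing from `S`. -/
def runStarts (S : Set ℤ) : Set ℤ := {x | x ∈ S ∧ x - 1 ∉ S}

/-- The charge of the runner `r` of the `t`-abacus with half charge vector `c`. -/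
def charge (t : ℕ) (c : ℕ → ℤ) (r : ℕ) : ℤ := c r - c (t - 1 - r)

/-- The set of beads on the `t`-abacus with half charge vector `c`. -/
def chargeBeads (t : ℕ) (c : ℕ → ℤ) : Set ℤ :=
  {x | x / t < charge t c (x % t).toNat}

theorem charge_rev {t r : ℕ} (hr : r < t) (c : ℕ → ℤ) :
    charge t c (t - 1 - r) = - charge t c r := by
  rw [charge, charge, show t - 1 - (t - 1 - r) = r by omega]
  ring

theorem mem_chargeBeads {t r : ℕ} (hr : r < t) (c : ℕ → ℤ) (k : ℤ) :
    (r : ℤ) + t * k ∈ chargeBeads t c ↔ k < charge t c r := by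
  have ht : (t : ℤ) ≠ 0 := by omega
  have h1 : ((r : ℤ) + t * k) / t = k := by
    rw [Int.add_mul_ediv_left _ _ ht, Int.ediv_eq_zero_of_lt (by omega) (by omega), zero_add]
  have h2 : ((r : ℤ) + t * k) % t = r := by
    rw [Int.add_mul_emod_self_left, Int.emod_eq_of_lt (by omega) (by omega)]
  change _ / _ < charge t c _ ↔ _
  rw [h1, h2, Int.toNat_natCast]

theorem exists_residue {t : ℕ} (ht : 0 < t) (x : ℤ) :
    ∃ r : ℕ, r < t ∧ ∃ k : ℤ, x = r + t * k := by
  have h1 := Int.emod_nonneg x (b := t) (by omega)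
  have h2 := Int.emod_lt_of_pos x (b := t) (by omega)
  refine ⟨(x % t).toNat, by omega, x / t, ?_⟩
  rw [Int.toNat_of_nonneg h1, Int.emod_add_mul_ediv]

theorem residue_unique {t r r' : ℕ} {k k' : ℤ} (hr : r < t) (hr' : r' < t)
    (h : (r : ℤ) + t * k = r' + t * k') : r = r' := by
  have h1 : ((r : ℤ) + t * k) % t = r := by
    rw [Int.add_mul_emod_self_left, Int.emod_eq_of_lt (by omega) (by omega)]
  rw [h, Int.add_mul_emod_self_left, Int.emod_eq_of_lt (by omega) (by omega)] at h1
  omega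

theorem isBeadSet_chargeBeads {t : ℕ} (ht : 0 < t) (c : ℕ → ℤ) :
    IsBeadSet t (chargeBeads t c) where
  symm x := by
    obtain ⟨r, hr, k, rfl⟩ := exists_residue ht x
    have : -1 - ((r : ℤ) + t * k) = ((t - 1 - r : ℕ) : ℤ) + t * (-1 - k) := by
      rw [show t - 1 - r = t - (1 + r) by omega, Nat.cast_sub (by omega)]
      push_cast
      ring
    rw [this, mem_chargeBeads hr, mem_chargeBeads (by omega), charge_rev hr]
    omega
  sub_mem x hx := by
    obtain ⟨r, hr, k, rfl⟩ := exists_residue ht x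
    rw [mem_chargeBeads hr] at hx
    rw [show (r : ℤ) + t * k - t = r + t * (k - 1) by ring, mem_chargeBeads hr]
    omega
  bddAbove := by
    refine ⟨∑ r ∈ Finset.range t, t * (1 + |charge t c r|), fun x hx => ?_⟩
    obtain ⟨r, hr, k, rfl⟩ := exists_residue ht x
    rw [mem_chargeBeads hr] at hx
    refine le_trans ?_ (Finset.single_le_sum (fun i _ => ?_) (Finset.mem_range.2 hr))
    · have : k ≤ |charge t c r| := hx.le.trans (le_abs_self _)
      nlinarith
    · positivity

/-- Each runner is closed downwards and bounded above; antisymmetry turns the upper bound into beads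
far below, so it is not empty. -/
theorem exists_mem_iff_lt {t : ℕ} (ht : 0 < t) {S : Set ℤ} (hS : IsBeadSet t S) (r : ℕ) :
    ∃ h : ℤ, ∀ k : ℤ, (r : ℤ) + t * k ∈ S ↔ k < h := by
  obtain ⟨B, hB⟩ := hS.bddAbove
  have hub : ∀ k : ℤ, (r : ℤ) + t * k ∈ S → k ≤ |B| := fun k hk => by
    have h1 := hB hk
    by_contra! h2
    have h3 := le_abs_self B
    have h4 := abs_nonneg B
    nlinarith
  have hlow : ∀ k : ℤ, k < -(|B| + r + 1) → (r : ℤ) + t * k ∈ S := fun k hk => by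
    rw [hS.symm]
    intro h
    have h1 := hB h
    have h3 := le_abs_self B
    have h4 := abs_nonneg B
    nlinarith
  obtain ⟨h, h1, h2⟩ := Int.exists_greatest_of_bdd (P := fun k => (r : ℤ) + t * k ∈ S) ⟨_, hub⟩
    ⟨_, hlow (-(|B| + r + 1) - 1) (by omega)⟩
  refine ⟨h + 1, fun k => ⟨fun hk => by have := h2 k hk; omega, fun hk => ?_⟩⟩
  have key : ∀ d : ℕ, (r : ℤ) + t * (h - d) ∈ S := fun d => by
    induction d with
    | zero => simpa using h1
    | succ d ih =>
      have := hS.sub_mem _ ih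
      push_cast
      convert this using 1
      ring
  convert key (h - k).toNat using 2
  rw [Int.toNat_of_nonneg (by omega)]
  ring

theorem charge_eq_of_lt {t r : ℕ} (hr : r < t / 2) {c : ℕ → ℤ} (hc : ∀ r, t / 2 ≤ r → c r = 0) :
    charge t c r = c r := by
  rw [charge, hc (t - 1 - r) (by omega), sub_zero]

theorem exists_chargeBeads_eq {t : ℕ} (ht : 0 < t) {S : Set ℤ} (hS : IsBeadSet t S) :
    ∃ c : ℕ → ℤ, (∀ r, t / 2 ≤ r → c r = 0) ∧ chargeBeads t c = S := by
  choose h hh using exists_mem_iff_lt ht hS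
  have hrev : ∀ r < t, h (t - 1 - r) = - h r := fun r hr => by
    have key : ∀ k : ℤ, k < h r ↔ ¬ (-1 - k < h (t - 1 - r)) := fun k => by
      rw [← hh, ← hh, hS.symm]
      have : -1 - ((r : ℤ) + t * k) = ((t - 1 - r : ℕ) : ℤ) + t * (-1 - k) := by
        rw [show t - 1 - r = t - (1 + r) by omega, Nat.cast_sub (by omega)]
        push_cast
        ring
      rw [this]
    have h1 := key (h r)
    have h2 := key (h r - 1)
    omega
  let c : ℕ → ℤ := fun r => if r < t / 2 then h r else 0
  have hc : ∀ r, t / 2 ≤ r → c r = 0 := fun r hr => if_neg (by omega)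
  have hlt : ∀ r < t / 2, charge t c r = h r := fun r hr => by
    rw [charge_eq_of_lt hr hc]
    exact if_pos hr
  have hcharge : ∀ r < t, charge t c r = h r := fun r hr => by
    by_cases h1 : r < t / 2
    · exact hlt r h1
    · by_cases h2 : t - 1 - r < t / 2
      · have h3 := hlt _ h2
        rw [charge_rev hr, hrev r hr] at h3
        omega
      -- The middle runner of an odd `t` is its own mirror image, so its charge is zero.
      · have h3 := hrev r hr
        rw [show t - 1 - r = r by omega] at h3
        rw [charge, hc _ (by omega), hc _ (by omega)]
        omega
  refine ⟨c, hc, Set.ext fun x => ?_⟩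
  obtain ⟨r, hr, k, rfl⟩ := exists_residue ht x
  rw [mem_chargeBeads hr, hh, hcharge r hr]

theorem chargeBeads_injOn (t : ℕ) :
    Set.InjOn (chargeBeads t) {c | ∀ r, t / 2 ≤ r → c r = 0} := by
  intro c hc d hd h
  funext r
  by_cases hr : r < t / 2
  · have key : ∀ k : ℤ, k < c r ↔ k < d r := fun k => by
      rw [← charge_eq_of_lt hr hc, ← charge_eq_of_lt hr hd,
        ← mem_chargeBeads (by omega), ← mem_chargeBeads (by omega), h]
    have h1 := key (c r)
    have h2 := key (d r)
    omega
  · rw [hc r (by omega), hd r (by omega)]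

/-- The charge of the runner that precedes the runner `r`, levels being shifted at `r = 0`. -/
def prevCharge (t : ℕ) (c : ℕ → ℤ) : ℕ → ℤ
  | 0 => 1 - charge t c 0
  | r + 1 => charge t c r

theorem pred_mem_chargeBeads {t r : ℕ} (hr : r < t) (c : ℕ → ℤ) (k : ℤ) :
    (r : ℤ) + t * k - 1 ∈ chargeBeads t c ↔ k < prevCharge t c r := by
  rcases r with _ | r
  · rw [show ((0 : ℕ) : ℤ) + t * k - 1 = ((t - 1 - 0 : ℕ) : ℤ) + t * (k - 1) by
        rw [Nat.sub_zero, Nat.cast_sub (by omega)]; push_cast; ring,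
      mem_chargeBeads (by omega), charge_rev hr, prevCharge]
    omega
  · rw [show ((r + 1 : ℕ) : ℤ) + t * k - 1 = r + t * k by push_cast; ring,
      mem_chargeBeads (by omega), prevCharge]

theorem ncard_runStarts_eq_sum {t : ℕ} (ht : 0 < t) (c : ℕ → ℤ) :
    ((runStarts (chargeBeads t c)).ncard : ℤ) =
      ∑ r ∈ Finset.range t, max (charge t c r - prevCharge t c r) 0 := by
  have h : runStarts (chargeBeads t c) = ↑((Finset.range t).biUnion fun r =>
      (Finset.Ico (prevCharge t c r) (charge t c r)).image fun k => (r : ℤ) + t * k) := by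
    ext x
    simp only [Finset.coe_biUnion, Finset.coe_range, Set.mem_Iio, Finset.coe_image,
      Finset.coe_Ico, Set.mem_iUnion, Set.mem_image, Set.mem_Ico, exists_prop]
    constructor
    · obtain ⟨r, hr, k, rfl⟩ := exists_residue ht x
      rintro ⟨h1, h2⟩
      rw [mem_chargeBeads hr] at h1
      rw [pred_mem_chargeBeads hr] at h2
      exact ⟨r, hr, k, ⟨by omega, h1⟩, rfl⟩
    · rintro ⟨r, hr, k, ⟨h1, h2⟩, rfl⟩
      refine ⟨(mem_chargeBeads hr c k).2 h2, ?_⟩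
      rw [pred_mem_chargeBeads hr]
      omega
  rw [h, Set.ncard_coe_finset, Finset.card_biUnion]
  · push_cast
    refine Finset.sum_congr rfl fun r _ => ?_
    rw [Finset.card_image_of_injective, Int.card_Ico]
    · omega
    · intro k k' hk
      have : (t : ℤ) ≠ 0 := by omega
      exact mul_left_cancel₀ this (add_left_cancel hk)
  · intro r hr r' hr' hne
    rw [Function.onFun, Finset.disjoint_left]
    simp only [Finset.mem_image, not_exists, not_and]
    rintro _ ⟨k, -, rfl⟩ k' - hk
    exact hne (residue_unique (Finset.mem_range.1 hr) (Finset.mem_range.1 hr') hk.symm)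

/-- The rises between consecutive runners are those of `c` together with their mirror images, hence
twice the ascent; the passage from the last runner to runner 0, one level up, gives `2 * c 0 - 1`.
-/
theorem ncard_runStarts_chargeBeads {t : ℕ} (ht : 0 < t) {c : ℕ → ℤ}
    (hc : ∀ r, t / 2 ≤ r → c r = 0) :
    ((runStarts (chargeBeads t c)).ncard : ℤ) =
      max (2 * c 0 - 1) 0 + 2 * ascent (t / 2) c := by
  obtain ⟨u, rfl⟩ : ∃ u, t = u + 1 := ⟨t - 1, by omega⟩
  have h0 : charge (u + 1) c 0 = c 0 := by
    rw [charge]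
    rcases u with _ | u
    · simp [hc 0]
    · rw [hc (u + 1 + 1 - 1 - 0) (by omega), sub_zero]
  have hstep : ∀ r ∈ Finset.range u,
      max (charge (u + 1) c (r + 1) - prevCharge (u + 1) c (r + 1)) 0 =
        max (c (r + 1) - c r) 0 + max (c (u - 1 - r + 1) - c (u - 1 - r)) 0 := fun r hr => by
    have hr : r < u := Finset.mem_range.1 hr
    simp only [prevCharge, charge, show u + 1 - 1 - (r + 1) = u - 1 - r by omega,
      show u + 1 - 1 - r = u - 1 - r + 1 by omega]
    rcases lt_trichotomy (r + 1) ((u + 1) / 2) with h | h | h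
    · rw [hc (u - 1 - r + 1) (by omega), hc (u - 1 - r) (by omega)]
      omega
    · rw [hc (r + 1) (by omega), hc (u - 1 - r + 1) (by omega)]
      by_cases h2 : u - 1 - r = r
      · rw [h2]; omega
      · rw [hc (u - 1 - r) (by omega)]; omega
    · rw [hc (r + 1) (by omega)]
      by_cases h2 : (u + 1) / 2 ≤ r
      · rw [hc r h2]; omega
      · omega
  rw [ncard_runStarts_eq_sum ht, Finset.sum_range_succ', Finset.sum_congr rfl hstep,
    Finset.sum_add_distrib, Finset.sum_range_reflect (fun r => max (c (r + 1) - c r) 0)]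
  change ascent u c + ascent u c + _ = _
  rw [ascent_eq_of_le (n := (u + 1) / 2) (N := u) (by omega) hc, prevCharge, h0]
  ring_nf

theorem encard_charges (t m : ℕ) :
    {c : ℕ → ℤ | (∀ r, t / 2 ≤ r → c r = 0) ∧
      max (2 * c 0 - 1) 0 + 2 * ascent (t / 2) c = m}.encard = scc t m := by
  rw [← walkCount_eq_scc, ← encard_walks]
  rcases Nat.even_or_odd' m with ⟨p, rfl | rfl⟩
  · congr 1
    rw [show (2 * p + 1) / 2 = p by omega, show 2 * p / 2 = p by omega, sub_self]
    ext c
    simp only [walks, Set.mem_ofPred_eq]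
    refine and_congr_right fun _ => ?_
    push_cast
    omega
  -- Odd `m` forces `c 0 > 0`, and `-c` has ascent `ascent (t / 2) c + c 0 = p + 1`.
  · rw [← (neg_injective (G := ℕ → ℤ)).encard_image]
    congr 1
    rw [show (2 * p + 1 + 1) / 2 = p + 1 by omega, show (2 * p + 1) / 2 = p by omega]
    ext c
    simp only [walks, Set.mem_ofPred_eq, Set.image_neg_eq_neg, Set.mem_neg, Pi.neg_apply,
      neg_eq_zero]
    refine and_congr_right fun hc => ?_
    rw [ascent_neg, hc _ le_rfl]
    have := ascent_nonneg (t / 2) c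
    have := le_ascent (t / 2) c
    rw [hc _ le_rfl] at this
    push_cast
    omega

theorem encard_beadSets {t : ℕ} (ht : 0 < t) (m : ℕ) :
    {S : Set ℤ | IsBeadSet t S ∧ (runStarts S).ncard = m}.encard = scc t m := by
  rw [← encard_charges, ← ((chargeBeads_injOn t).mono fun c hc => hc.1).encard_image]
  congr 1
  ext S
  constructor
  · rintro ⟨h1, h2⟩
    obtain ⟨c, hc, rfl⟩ := exists_chargeBeads_eq ht h1
    exact ⟨c, ⟨hc, by rw [← ncard_runStarts_chargeBeads ht hc, h2]⟩, rfl⟩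
  · rintro ⟨c, ⟨hc, h⟩, rfl⟩
    refine ⟨isBeadSet_chargeBeads ht c, ?_⟩
    rw [← ncard_runStarts_chargeBeads ht hc] at h
    exact_mod_cast h

/-! ### Bead sets of self-conjugate diagrams -/

namespace YoungDiagram

/-- The position of the bead of `μ` that stands for its row `i`. -/
def bead (μ : YoungDiagram) (i : ℕ) : ℤ := μ.rowLen i - i - 1

/-- The bead set (Maya diagram) of `μ`. -/
def beads (μ : YoungDiagram) : Set ℤ := Set.range μ.bead

theorem bead_strictAnti (μ : YoungDiagram) : StrictAnti μ.bead := fun i j h => by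
  have := μ.rowLen_anti i j h.le
  unfold bead
  omega

theorem eq_of_mem_iff {μ ν : YoungDiagram} (h : ∀ i j, (i, j) ∈ μ ↔ (i, j) ∈ ν) : μ = ν :=
  YoungDiagram.ext (Finset.ext fun ⟨i, j⟩ => h i j)

theorem IsSelfConjugate.mem_swap {μ : YoungDiagram} (h : μ.IsSelfConjugate) (i j : ℕ) :
    (i, j) ∈ μ ↔ (j, i) ∈ μ := by
  have h1 := mem_transpose (μ := μ) (c := (j, i))
  rw [show μ.transpose = μ from h] at h1
  exact h1.symm

/-- The sum is `(rowLen i - j - 1) + (rowLen j - i - 1)`, and by symmetry both terms are nonnegative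
or both negative; hence it is also never `-1`. -/
theorem IsSelfConjugate.mem_iff_bead {μ : YoungDiagram} (h : μ.IsSelfConjugate) (i j : ℕ) :
    (i, j) ∈ μ ↔ 0 ≤ μ.bead i + μ.bead j := by
  have h1 := h.mem_swap i j
  rw [mem_iff_lt_rowLen, mem_iff_lt_rowLen] at h1
  rw [mem_iff_lt_rowLen, bead, bead]
  omega

theorem IsSelfConjugate.bead_add_bead_ne {μ : YoungDiagram} (h : μ.IsSelfConjugate) (i j : ℕ) :
    μ.bead i + μ.bead j ≠ -1 := by
  have h1 := h.mem_swap i j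
  rw [mem_iff_lt_rowLen, mem_iff_lt_rowLen] at h1
  rw [bead, bead]
  omega

theorem IsSelfConjugate.mem_beads_iff {μ : YoungDiagram} (h : μ.IsSelfConjugate) (x : ℤ) :
    x ∈ μ.beads ↔ -1 - x ∉ μ.beads := by
  constructor
  · rintro ⟨i, rfl⟩ ⟨j, hj⟩
    exact h.bead_add_bead_ne i j (by omega)
  · intro hx
    by_contra hx'
    have hex : ∃ i, μ.bead i ≤ x := by
      refine ⟨(μ.rowLen 0 - x).toNat, ?_⟩
      have := μ.rowLen_anti 0 (μ.rowLen 0 - x).toNat (Nat.zero_le _)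
      unfold bead
      omega
    classical
    obtain ⟨i, hi, hmin⟩ : ∃ i, μ.bead i ≤ x ∧ ∀ k < i, ¬ μ.bead k ≤ x :=
      ⟨Nat.find hex, Nat.find_spec hex, fun k hk => Nat.find_min hex hk⟩
    have hne : μ.bead i ≠ x := fun h => hx' ⟨i, h⟩
    unfold bead at hi hmin hne
    -- Column `x + i` has exactly `i` boxes; by symmetry so has row `j = x + i`, and its bead is `-1
    -- - x`.
    obtain ⟨j, hj⟩ : ∃ j : ℕ, (j : ℤ) = x + i := ⟨(x + i).toNat, by omega⟩
    have hlt : ∀ k, k < μ.rowLen j ↔ k < i := fun k => by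
      rw [← mem_iff_lt_rowLen, h.mem_swap, mem_iff_lt_rowLen]
      constructor
      · intro hk
        by_contra! hki
        have := μ.rowLen_anti _ _ hki
        omega
      · intro hk
        have h1 := hmin (i - 1) (by omega)
        have h2 := μ.rowLen_anti k (i - 1) (by omega)
        omega
    have h1 := hlt i
    have h2 := hlt (μ.rowLen j)
    refine hx ⟨j, ?_⟩
    unfold bead
    omega

theorem IsSelfConjugate.isCore_iff {μ : YoungDiagram} (h : μ.IsSelfConjugate) {t : ℕ}
    (ht : 0 < t) : μ.IsCore t ↔ ∀ x ∈ μ.beads, x - t ∈ μ.beads := by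
  have hhook : ∀ i j, (i, j) ∈ μ → (μ.hookLength i j : ℤ) = μ.bead i + μ.bead j + 1 := by
    intro i j hij
    have h1 := (h.mem_swap i j).1 hij
    rw [mem_iff_lt_rowLen] at hij h1
    rw [hookLength, ← rowLen_transpose, h, bead, bead]
    omega
  constructor
  · rintro hc _ ⟨i, rfl⟩
    rw [h.mem_beads_iff]
    rintro ⟨j, hj⟩
    have hij : (i, j) ∈ μ := by rw [h.mem_iff_bead]; omega
    have h1 := hhook i j hij
    exact hc i j hij (by omega)
  · intro hc i j hij ht'
    have h1 := hc _ ⟨i, rfl⟩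
    rw [h.mem_beads_iff] at h1
    have h2 := hhook i j hij
    exact h1 ⟨j, by omega⟩

theorem isBeadSet_beads {μ : YoungDiagram} (h : μ.IsSelfConjugate) {t : ℕ} (ht : 0 < t)
    (hc : μ.IsCore t) : IsBeadSet t μ.beads where
  symm := h.mem_beads_iff
  sub_mem := (h.isCore_iff ht).1 hc
  bddAbove := ⟨μ.bead 0, by
    rintro _ ⟨i, rfl⟩
    exact μ.bead_strictAnti.antitone (Nat.zero_le i)⟩

theorem mem_innerCorners_iff (μ : YoungDiagram) (i j : ℕ) :
    (i, j) ∈ μ.innerCorners ↔ (i, j) ∈ μ ∧ (i + 1, j) ∉ μ ∧ (i, j + 1) ∉ μ := by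
  refine and_congr_right fun hij => ⟨fun hl => ⟨fun h => ?_, fun h => ?_⟩, ?_⟩
  · have := @hl (i + 1, j) (i, j) (by simp) (by simpa using h)
    simp at this
  · have := @hl (i, j + 1) (i, j) (by simp) (by simpa using h)
    simp at this
  · rintro ⟨h1, h2⟩ ⟨a, b⟩ ⟨a', b'⟩ hle hab
    simp only [Finset.coe_erase, Set.mem_sdiff, Finset.mem_coe, mem_cells,
      Set.mem_singleton_iff, Prod.mk.injEq] at hab ⊢
    obtain ⟨hle1, hle2⟩ : a' ≤ a ∧ b' ≤ b := hle
    refine ⟨μ.up_left_mem hle1 hle2 hab.1, ?_⟩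
    rintro ⟨rfl, rfl⟩
    rcases hle1.lt_or_eq with h | rfl
    · exact h1 (μ.up_left_mem h hle2 hab.1)
    · rcases hle2.lt_or_eq with h | rfl
      · exact h2 (μ.up_left_mem le_rfl h hab.1)
      · exact hab.2 ⟨rfl, rfl⟩

theorem numCorners_eq_ncard_runStarts (μ : YoungDiagram) :
    μ.numCorners = (runStarts μ.beads).ncard := by
  have h1 : μ.innerCorners =
      (fun i => (i, μ.rowLen i - 1)) '' {i | μ.rowLen (i + 1) < μ.rowLen i} := by
    ext ⟨i, j⟩
    rw [mem_innerCorners_iff]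
    simp only [mem_iff_lt_rowLen, Set.mem_image, Set.mem_ofPred_eq, Prod.mk.injEq]
    constructor
    · intro h
      exact ⟨i, by omega, rfl, by omega⟩
    · rintro ⟨k, hk, rfl, rfl⟩
      omega
  have h2 : runStarts μ.beads = μ.bead '' {i | μ.rowLen (i + 1) < μ.rowLen i} := by
    ext x
    constructor
    · rintro ⟨⟨i, rfl⟩, hx⟩
      refine ⟨i, ?_, rfl⟩
      change μ.rowLen (i + 1) < μ.rowLen i
      by_contra hlt
      refine hx ⟨i + 1, ?_⟩
      have := μ.rowLen_anti i (i + 1) (by omega)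
      unfold bead
      omega
    · rintro ⟨i, hi, rfl⟩
      replace hi : μ.rowLen (i + 1) < μ.rowLen i := hi
      refine ⟨⟨i, rfl⟩, ?_⟩
      rintro ⟨k, hk⟩
      have hik : i < k := μ.bead_strictAnti.lt_iff_gt.1 (by omega)
      have := μ.rowLen_anti (i + 1) k hik
      unfold bead at hk
      omega
  rw [numCorners, h1, h2, Set.ncard_image_of_injective _ μ.bead_strictAnti.injective,
    Set.ncard_image_of_injective _ fun i k h => (Prod.mk.inj h).1]

theorem beads_injective : Function.Injective beads := fun μ ν h => by
  have hb : (fun i => -μ.bead i) = fun i => -ν.bead i := by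
    refine (StrictMono.range_inj μ.bead_strictAnti.neg ν.bead_strictAnti.neg).1 ?_
    have := congrArg (fun S : Set ℤ => Neg.neg '' S) h
    simp only [beads, ← Set.range_comp] at this
    exact this
  refine eq_of_mem_iff fun i j => ?_
  have := congrFun hb i
  simp only [bead] at this
  rw [mem_iff_lt_rowLen, mem_iff_lt_rowLen]
  omega

end YoungDiagram

open YoungDiagram

/-! ### Reconstructing the diagram from its beads -/

theorem IsBeadSet.exists_strictAnti {t : ℕ} {S : Set ℤ} (hS : IsBeadSet t S) :
    ∃ b : ℕ → ℤ, StrictAnti b ∧ Set.range b = S := by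
  classical
  obtain ⟨N, hN⟩ := hS.bddAbove
  let T : Set ℕ := {k | N - k ∈ S}
  have hT : T.Infinite := by
    refine Set.infinite_of_forall_exists_gt fun a => ?_
    -- Far enough down that the reflected point exceeds the bound `N`.
    refine ⟨(2 * |N| + 1).toNat + a + 1, ?_, by omega⟩
    change N - _ ∈ S
    rw [hS.symm]
    intro h
    have h1 := hN h
    have := le_abs_self N
    have := abs_nonneg N
    push_cast at h1
    omega
  have : Infinite T := hT.to_subtype
  refine ⟨fun i => N - Nat.orderEmbeddingOfSet T i, fun i j h => ?_, Set.ext fun x => ?_⟩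
  · have := (Nat.orderEmbeddingOfSet T).strictMono h
    change N - _ < N - _
    omega
  · have hr := Nat.orderEmbeddingOfSet_range T
    constructor
    · rintro ⟨i, rfl⟩
      have : Nat.orderEmbeddingOfSet T i ∈ T := hr.subset (Set.mem_range_self i)
      exact this
    · intro hx
      have hle := hN hx
      have : (N - x).toNat ∈ T := by
        change N - _ ∈ S
        rwa [Int.toNat_of_nonneg (by omega), sub_sub_cancel]
      rw [← hr] at this
      obtain ⟨i, hi⟩ := this
      refine ⟨i, ?_⟩
      change N - (Nat.orderEmbeddingOfSet T i : ℤ) = x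
      omega

theorem StrictAnti.le_sub_natCast {b : ℕ → ℤ} (hb : StrictAnti b) (i : ℕ) : b i ≤ b 0 - i := by
  induction i with
  | zero => simp
  | succ i ih =>
    have := hb (show i < i + 1 by omega)
    push_cast
    omega

/-- The self-conjugate Young diagram with the boxes `(i, j)` such that `0 ≤ b i + b j`. -/
def diagramOfBeads (b : ℕ → ℤ) (hb : StrictAnti b) : YoungDiagram where
  cells := (Finset.range (2 * b 0 + 1).toNat ×ˢ Finset.range (2 * b 0 + 1).toNat).filter
    fun p => 0 ≤ b p.1 + b p.2
  isLowerSet := by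
    rintro ⟨i, j⟩ ⟨i', j'⟩ ⟨h1, h2⟩ h
    simp only [Finset.coe_filter, Finset.mem_product, Finset.mem_range, Set.mem_ofPred_eq] at *
    have := hb.antitone h1
    have := hb.antitone h2
    omega

theorem mem_diagramOfBeads {b : ℕ → ℤ} (hb : StrictAnti b) (i j : ℕ) :
    (i, j) ∈ diagramOfBeads b hb ↔ 0 ≤ b i + b j := by
  rw [← mem_cells]
  simp only [diagramOfBeads, Finset.mem_filter, Finset.mem_product, Finset.mem_range,
    and_iff_right_iff_imp]
  have h1 := hb.le_sub_natCast i
  have h2 := hb.le_sub_natCast j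
  omega

theorem isSelfConjugate_diagramOfBeads {b : ℕ → ℤ} (hb : StrictAnti b) :
    (diagramOfBeads b hb).IsSelfConjugate :=
  eq_of_mem_iff fun i j => by
    rw [mem_transpose, Prod.swap_prod_mk, mem_diagramOfBeads, mem_diagramOfBeads, add_comm]

/-- No bead lies strictly between `b (i + 1)` and `b i`, so by antisymmetry every reflected point is
a bead; these beads index the columns in which row `i` exceeds row `i + 1`. -/
theorem rowLen_diagramOfBeads_sub {b : ℕ → ℤ} (hb : StrictAnti b)
    (hs : ∀ x, x ∈ Set.range b ↔ -1 - x ∉ Set.range b) (i : ℕ) :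
    ((diagramOfBeads b hb).rowLen i : ℤ) - (diagramOfBeads b hb).rowLen (i + 1) =
      b i - b (i + 1) - 1 := by
  have hlt : ∀ i j, j < (diagramOfBeads b hb).rowLen i ↔ 0 ≤ b i + b j := fun i j => by
    rw [← mem_iff_lt_rowLen, mem_diagramOfBeads]
  have himg : (Finset.Ico ((diagramOfBeads b hb).rowLen (i + 1))
      ((diagramOfBeads b hb).rowLen i)).image b = Finset.Ico (-b i) (-b (i + 1) - 1) := by
    ext y
    simp only [Finset.mem_image, Finset.mem_Ico, hlt,
      ← not_lt (b := (diagramOfBeads b hb).rowLen (i + 1))]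
    constructor
    · rintro ⟨j, ⟨h1, h2⟩, rfl⟩
      have h3 : -1 - b (i + 1) ≠ b j := fun h => (hs (b (i + 1))).1 ⟨_, rfl⟩ ⟨j, h.symm⟩
      omega
    · rintro ⟨h1, h2⟩
      obtain ⟨j, rfl⟩ : y ∈ Set.range b := by
        rw [hs]
        rintro ⟨k, hk⟩
        have h3 : i < k := hb.lt_iff_gt.1 (by omega)
        have h4 : k < i + 1 := hb.lt_iff_gt.1 (by omega)
        omega
      exact ⟨j, by omega, rfl⟩
  have hcard := congrArg Finset.card himg
  rw [Finset.card_image_of_injective _ hb.injective, Nat.card_Ico, Int.card_Ico] at hcard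
  have h1 := (diagramOfBeads b hb).rowLen_anti i (i + 1) (by omega)
  have h2 := hb (show i < i + 1 by omega)
  omega

/-- Equal gaps give equality up to a shift `k`. Both sets are antisymmetric, so `Set.range b` is
invariant under `2 * k`; having a maximum, it forces `k = 0`. -/
theorem beads_diagramOfBeads {b : ℕ → ℤ} (hb : StrictAnti b)
    (hs : ∀ x, x ∈ Set.range b ↔ -1 - x ∉ Set.range b) :
    (diagramOfBeads b hb).beads = Set.range b := by
  obtain ⟨k, hk⟩ : ∃ k : ℤ, ∀ i, (diagramOfBeads b hb).bead i = b i + k := by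
    refine ⟨(diagramOfBeads b hb).bead 0 - b 0, fun i => ?_⟩
    induction i with
    | zero => ring
    | succ i ih =>
      have := rowLen_diagramOfBeads_sub hb hs i
      unfold bead at *
      push_cast
      omega
  have hmem : ∀ x, x + k ∈ (diagramOfBeads b hb).beads ↔ x ∈ Set.range b := fun x => by
    simp [beads, hk]
  have hinv : ∀ x, x ∈ Set.range b ↔ x + 2 * k ∈ Set.range b := fun x => by
    rw [← hmem, (isSelfConjugate_diagramOfBeads hb).mem_beads_iff,
      show -1 - (x + k) = (-1 - (x + 2 * k)) + k by ring, hmem, hs (x + 2 * k)]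
  have hmax : ∀ x ∈ Set.range b, x ≤ b 0 := by
    rintro _ ⟨i, rfl⟩
    exact hb.antitone (Nat.zero_le i)
  have h1 := hmax _ ((hinv (b 0)).1 ⟨0, rfl⟩)
  have h2 := hmax (b 0 - 2 * k) ((hinv _).2 (by rw [sub_add_cancel]; exact ⟨0, rfl⟩))
  obtain rfl : k = 0 := by omega
  ext x
  rw [← hmem, add_zero]

theorem encard_selfConjugateCores {t : ℕ} (ht : 0 < t) (m : ℕ) :
    (selfConjugateCores t m).encard = scc t m := by
  rw [← encard_beadSets ht, ← beads_injective.encard_image]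
  congr 1
  ext S
  constructor
  · rintro ⟨μ, ⟨h1, h2, h3⟩, rfl⟩
    exact ⟨isBeadSet_beads h1 ht h2, by rw [← numCorners_eq_ncard_runStarts, h3]⟩
  · rintro ⟨hS, hm⟩
    obtain ⟨b, hb, rfl⟩ := hS.exists_strictAnti
    have hbeads := beads_diagramOfBeads hb hS.symm
    have hsc := isSelfConjugate_diagramOfBeads hb
    refine ⟨diagramOfBeads b hb, ⟨hsc, ?_, ?_⟩, hbeads⟩
    · rw [hsc.isCore_iff ht, hbeads]
      exact hS.sub_mem
    · rw [numCorners_eq_ncard_runStarts, hbeads, hm]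

theorem scc_eq_scc_succ (t m : ℕ) (ht : Even t) : scc t m = scc (t + 1) m := by
  obtain ⟨n, rfl⟩ := ht
  rw [scc, scc, show (n + n + 1) / 2 = (n + n) / 2 by omega]

theorem mainTheorem8 :
    (∀ t m : ℕ, 0 < t →
      (selfConjugateCores t m).Finite ∧ (selfConjugateCores t m).ncard = scc t m) ∧
    (∀ t m : ℕ, Even t → scc t m = scc (t + 1) m) ∧
    (∀ t m : ℕ, 0 < t → Even t →
      (selfConjugateCores t m).ncard = (selfConjugateCores (t + 1) m).ncard) := by
  have hcard : ∀ t m : ℕ, 0 < t → (selfConjugateCores t m).ncard = scc t m := fun t m ht => by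
    rw [Set.ncard, encard_selfConjugateCores ht, ENat.toNat_natCast]
  refine ⟨fun t m ht => ⟨?_, hcard t m ht⟩, scc_eq_scc_succ, fun t m ht he => ?_⟩
  · exact Set.finite_of_encard_eq_coe (encard_selfConjugateCores ht m)
  · rw [hcard t m ht, hcard (t + 1) m (by omega), scc_eq_scc_succ t m he]
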